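/- Let $A\subset\mathbb R^2$ be a finite set of at least four points, no three of them collinear, and let $\omega:A\to\mathbb R$ be a height function such that no four of the lifted points $p'=(p_1,p_2,\omega(p))$, $p\in A$, are coplanar. Write $X'=\{p' : p\in X\}$ for $X\subseteq A$; in particular $A^\omega=A'$ is the lifted point set. A *triangulation* of a finite point set $P$ is a (geometric) simplicial complex with vertices in $P$ (not necessarily all of them) whose underlying space is $\operatorname{conv}(P)$; that is, a set of simplices with vertices in $P$ such that all faces of its simplices belong to it (closure property), any two of its simplices meet in a possibly empty common face (intersection property), and its simplices have union $\operatorname{conv}(P)$ (union property). The *regular* (respectively *farthest-point regular*) triangulation of $(A,\omega)$ is the one whose triangles are the vertical projections of the lower (respectively upper) facets of the polytope $\operatorname{conv}(A^\omega)\subset\mathbb R^3$. A *flip* with support $Q\subseteq A$, $|Q|=4$, replaces a triangulation of $Q$ that is contained in a triangulation $T_1$ of $A$ by the other triangulation of $Q$, so that a triangulation $T_2$ of $A$ results. Its *tetrahedron* is $\operatorname{conv}(Q')$. The flip is an *up-flip* if the projected lower faces of this tetrahedron are in $T_1$ and the projected upper faces are in $T_2$, and a *down-flip* if the projected upper faces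 are in $T_1$ and the projected lower faces are in $T_2$. A sequence of flips is *monotone* if all of its flips are up-flips or all of them are down-flips. **Theorem.** Let $T_0,T_1,\dots,T_m$ be triangulations of $A$ such that, for $0\le i<m$, $T_{i+1}$ arises from $T_i$ by a flip with support $Q_i$ and tetrahedron $t_i=\operatorname{conv}(Q_i')$. Suppose that this sequence of flips is monotone, and that one of $T_0,T_m$ is the regular and the other is the farthest-point regular triangulation of $(A,\omega)$. Then the tetrahedra $t_0,\dots,t_{m-1}$ are pairwise distinct and, together with all their faces, form a triangulation of the lifted point set $A^\omega$. In particular this set of simplices has the closure, intersection and union properties, and $\bigcup_{i<m}t_i=\operatorname{conv}(A^\omega)$. This triangulation consists precisely of the tetrahedra $t_i$ and of the lifted simplices $\operatorname{conv}(X')$, where $X$ is the vertex set of a simplex of one of the triangulations $T_0,\dots,T_m$. -/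

import Mathlib

namespace FlipTriangulation

/-- The plane. -/
abbrev Plane : Type := EuclideanSpace ℝ (Fin 2)

/-- Three-dimensional space. -/
abbrev Space : Type := EuclideanSpace ℝ (Fin 3)

/-- The lifting map `(p₁, p₂) ↦ (p₁, p₂, ω p)` of a height function, as an injection.
Only the heights of the points of the point set under consideration ever matter. -/
def lift (ω : Plane → ℝ) : Plane ↪ Space where
  toFun p := !₂[p 0, p 1, ω p]
  inj' := by
    intro p q h
    have h0 := congrArg (fun x : Space => x 0) h
    have h1 := congrArg (fun x : Space => x 1) h
    ext i
    fin_cases i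
    · simpa using h0
    · simpa using h1

/-- The lifted point set of `A`. -/
def lifted (ω : Plane → ℝ) (A : Finset Plane) : Finset Space := A.map (lift ω)

/-- The canonical projection, which deletes the last coordinate. -/
def proj (x : Space) : Plane := !₂[x 0, x 1]

/-- `A` is in general position: no three of its points lie on a line. -/
def GeneralPosition (A : Finset Plane) : Prop :=
  ∀ s ⊆ A, s.card = 3 → ¬ Collinear ℝ (s : Set Plane)

/-- `ω` is sufficiently generic on `A`: no four points of `A` are lifted into a plane. -/
def GenericHeight (ω : Plane → ℝ) (A : Finset Plane) : Prop :=
  ∀ s ⊆ A, s.card = 4 → ¬ Coplanar ℝ (lifted ω s : Set Space)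

/-- A triangulation of a finite point set `P`: a geometric simplicial complex (closure and
intersection properties) with vertices in `P` whose underlying space is the convex hull of `P`
(union property). Mathlib's complexes leave out the empty simplex. -/
structure IsTriangulation {E : Type*} [AddCommGroup E] [Module ℝ E]
    (P : Finset E) (K : Geometry.SimplicialComplex ℝ E) : Prop where
  subset : ∀ s ∈ K.faces, s ⊆ P
  space_eq : K.space = convexHull ℝ (P : Set E)

/-- `F` is the set of points of `P` on a lower facet of `conv P`: some non-vertical plane, the graph
of an affine function `h`, lies nowhere above `P`, it meets `P` exactly in `F`, and `F` is not
contained in a line. -/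
def IsLowerFace (P F : Finset Space) : Prop :=
  F ⊆ P ∧ ¬ Collinear ℝ (F : Set Space) ∧
    ∃ h : Plane →ᵃ[ℝ] ℝ, ∀ x ∈ P, h (proj x) ≤ x 2 ∧ (x ∈ F ↔ h (proj x) = x 2)

/-- `F` is the set of points of `P` on an upper facet of `conv P`. -/
def IsUpperFace (P F : Finset Space) : Prop :=
  F ⊆ P ∧ ¬ Collinear ℝ (F : Set Space) ∧
    ∃ h : Plane →ᵃ[ℝ] ℝ, ∀ x ∈ P, x 2 ≤ h (proj x) ∧ (x ∈ F ↔ h (proj x) = x 2)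

/-- `K` is the regular triangulation of `(A, ω)`: its triangles are the projections of the lower
facets of the convex hull of the lifted point set. -/
def IsRegular (ω : Plane → ℝ) (A : Finset Plane) (K : Geometry.SimplicialComplex ℝ Plane) : Prop :=
  IsTriangulation A K ∧
    ∀ s : Finset Plane, s.card = 3 → (s ∈ K.faces ↔ IsLowerFace (lifted ω A) (lifted ω s))

/-- `K` is the farthest-point regular triangulation of `(A, ω)`: its triangles are the projections
of the upper facets of the convex hull of the lifted point set. -/
def IsFarthestRegular (ω : Plane → ℝ) (A : Finset Plane)
    (K : Geometry.SimplicialComplex ℝ Plane) : Prop :=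
  IsTriangulation A K ∧
    ∀ s : Finset Plane, s.card = 3 → (s ∈ K.faces ↔ IsUpperFace (lifted ω A) (lifted ω s))

/-- The triangulation `T₂` of `A` arises from the triangulation `T₁` by the flip that is supported by
the four points `Q`: a triangulation of `Q` contained in `T₁` is replaced by another one. -/
def IsFlip (A Q : Finset Plane) (T₁ T₂ : Geometry.SimplicialComplex ℝ Plane) : Prop :=
  IsTriangulation A T₁ ∧ IsTriangulation A T₂ ∧ Q ⊆ A ∧ Q.card = 4 ∧
    ∃ S₁ S₂ : Geometry.SimplicialComplex ℝ Plane,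
      IsTriangulation Q S₁ ∧ IsTriangulation Q S₂ ∧ S₁ ≠ S₂ ∧
        S₁.faces ⊆ T₁.faces ∧ T₂.faces = (T₁.faces \ S₁.faces) ∪ S₂.faces

/-- An up-flip: the lower faces of the tetrahedron with vertex set `lifted ω Q` appear in `T₁`
and its upper faces appear in `T₂`. -/
def IsUpFlip (ω : Plane → ℝ) (A Q : Finset Plane)
    (T₁ T₂ : Geometry.SimplicialComplex ℝ Plane) : Prop :=
  IsFlip A Q T₁ T₂ ∧
    (∀ s : Finset Plane, IsLowerFace (lifted ω Q) (lifted ω s) → s ∈ T₁.faces) ∧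
    (∀ s : Finset Plane, IsUpperFace (lifted ω Q) (lifted ω s) → s ∈ T₂.faces)

/-- A down-flip: the upper faces of the tetrahedron with vertex set `lifted ω Q` appear in `T₁`
and its lower faces appear in `T₂`. -/
def IsDownFlip (ω : Plane → ℝ) (A Q : Finset Plane)
    (T₁ T₂ : Geometry.SimplicialComplex ℝ Plane) : Prop :=
  IsFlip A Q T₁ T₂ ∧
    (∀ s : Finset Plane, IsUpperFace (lifted ω Q) (lifted ω s) → s ∈ T₁.faces) ∧
    (∀ s : Finset Plane, IsLowerFace (lifted ω Q) (lifted ω s) → s ∈ T₂.faces)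

/-- `T 0, …, T m` is a monotone sequence of directed flips with supports `Q 0, …, Q (m - 1)`:
all flips are up-flips, or all are down-flips. -/
def IsMonotoneFlipSequence (ω : Plane → ℝ) (A : Finset Plane) (m : ℕ)
    (T : Fin (m + 1) → Geometry.SimplicialComplex ℝ Plane) (Q : Fin m → Finset Plane) : Prop :=
  (∀ i : Fin m, IsUpFlip ω A (Q i) (T i.castSucc) (T i.succ)) ∨
    (∀ i : Fin m, IsDownFlip ω A (Q i) (T i.castSucc) (T i.succ))

end FlipTriangulation

namespace FlipTriangulation

/-! Lift each triangulation `T j` to a surface over `conv A`: the point above `x` has the height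
obtained by interpolating `ω` with the barycentric coordinates of `x` in `T j`. These coordinates
are functions on the whole plane that vanish off the carrying simplex, so coordinates from different
complexes can be compared as functions. They are unique for each complex (`IsRep.unique`).

Four points in general position carry one affine dependence up to scale; give it the sign with
positive total height. Subtracting multiples of it moves a point of the tetrahedron vertically down
to a lower face, and adding multiples moves it up to an upper face. Hence an up-flip leaves the
surface unchanged outside `conv Q` and pushes it from the bottom to the top of the tetrahedron over
`conv Q` (`IsUpStep.eq_or_isBary`). Over each `x` the heights therefore increase weakly along the
sequence, and they stay equal only if the coordinates do.

Intersections: at a common point of tetrahedra `i < j` its height is at most that of surface `i +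
1`, then of surface `j`, then its height again. All these coincide, so the point has the same
coordinates in both tetrahedra and lies in their common face.

Union: a generic interior point lies strictly above the regular surface and below the farthest-point
regular one, so some flip sweeps over it. Such points are dense in the hull, and a finite union of
tetrahedra is closed. Down-flips are the same sequence read backwards. -/

/-- `w` is a system of nonnegative weights on `s`, of total weight one, with barycenter `x`. -/
structure IsBary {E : Type*} [AddCommGroup E] [Module ℝ E] (s : Finset E) (w : E → ℝ) (x : E) :
    Prop where
  nonneg : ∀ p, 0 ≤ w p
  zero : ∀ p, p ∉ s → w p = 0
  sum : ∑ p ∈ s, w p = 1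
  comb : ∑ p ∈ s, w p • p = x

/-! ### Barycentric weights and coordinates in a complex -/

section Bary

variable {E : Type*} [AddCommGroup E] [Module ℝ E] {s t : Finset E} {w v : E → ℝ} {x : E}

theorem IsBary.mono (h : IsBary s w x) (hst : s ⊆ t) : IsBary t w x where
  nonneg := h.nonneg
  zero p hp := h.zero p fun hs => hp (hst hs)
  sum := by rw [← h.sum]; exact (Finset.sum_subset hst fun p _ hp => h.zero p hp).symm
  comb := by
    rw [← h.comb]
    exact (Finset.sum_subset hst fun p _ hp => by rw [h.zero p hp, zero_smul]).symm

theorem IsBary.restrict (h : IsBary s w x) (hts : t ⊆ s) (h0 : ∀ p, p ∉ t → w p = 0) :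
    IsBary t w x where
  nonneg := h.nonneg
  zero := h0
  sum := by rw [← h.sum]; exact Finset.sum_subset hts fun p _ hp => h0 p hp
  comb := by
    rw [← h.comb]
    exact Finset.sum_subset hts fun p _ hp => by rw [h0 p hp, zero_smul]

theorem mem_convexHull_iff_exists_isBary :
    x ∈ convexHull ℝ (s : Set E) ↔ ∃ w, IsBary s w x := by
  classical
  rw [Finset.mem_convexHull']
  constructor
  · rintro ⟨w, h0, h1, h2⟩
    refine ⟨fun p => if p ∈ s then w p else 0, ⟨fun p => ?_, fun p hp => if_neg hp, ?_, ?_⟩⟩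
    · split_ifs with hp
      exacts [h0 p hp, le_rfl]
    · rw [← h1]; exact Finset.sum_congr rfl fun p hp => if_pos hp
    · rw [← h2]; exact Finset.sum_congr rfl fun p hp => by rw [if_pos hp]
  · rintro ⟨w, hw⟩
    exact ⟨w, fun p _ => hw.nonneg p, hw.sum, hw.comb⟩

theorem IsBary.mem_convexHull (h : IsBary s w x) : x ∈ convexHull ℝ (s : Set E) :=
  mem_convexHull_iff_exists_isBary.2 ⟨w, h⟩

theorem affineIndependent_coe_iff :
    AffineIndependent ℝ ((↑) : s → E) ↔ ∀ w : E → ℝ, ∑ p ∈ s, w p = 0 →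
      ∑ p ∈ s, w p • p = 0 → ∀ p ∈ s, w p = 0 := by
  classical
  constructor
  · intro h w h0 h1 p hp
    refine h.eq_zero_of_sum_eq_zero (s := Finset.univ) (w := fun q : s => w q) ?_ ?_ ⟨p, hp⟩
      (Finset.mem_univ _)
    · rw [← h0]; exact Finset.sum_coe_sort s w
    · rw [← h1]; exact Finset.sum_coe_sort s fun q => w q • q
  · intro h
    by_contra hn
    obtain ⟨f, h1, h0, p, hp, hne⟩ := exists_nontrivial_relation_sum_zero_of_not_affine_ind hn
    exact hne (h f h0 h1 p hp)

theorem IsBary.unique (hs : AffineIndependent ℝ ((↑) : s → E)) (hw : IsBary s w x)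
    (hv : IsBary s v x) : w = v := by
  funext p
  by_cases hp : p ∈ s
  · refine sub_eq_zero.1 (affineIndependent_coe_iff.1 hs (fun p => w p - v p) ?_ ?_ p hp)
    · rw [Finset.sum_sub_distrib, hw.sum, hv.sum, sub_self]
    · simp only [sub_smul]
      rw [Finset.sum_sub_distrib, hw.comb, hv.comb, sub_self]
  · rw [hw.zero p hp, hv.zero p hp]

/-- Supplies a relative interior point: by `IsBary.subset_of_pos`, any set on which the same weights
are barycentric contains all of `s`. -/
theorem isBary_uniform (hs : s.Nonempty) :
    ∃ (w : E → ℝ) (x : E), IsBary s w x ∧ ∀ p ∈ s, 0 < w p := by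
  classical
  have hc : (0 : ℝ) < s.card := by exact_mod_cast hs.card_pos
  refine ⟨fun p => if p ∈ s then (s.card : ℝ)⁻¹ else 0, _,
    ⟨fun p => ?_, fun p hp => if_neg hp, ?_, rfl⟩, fun p hp => ?_⟩
  · split_ifs
    exacts [(inv_pos.2 hc).le, le_rfl]
  · rw [Finset.sum_congr rfl fun p hp => if_pos hp]
    simp [hc.ne']
  · simp [hp, hs]

theorem IsBary.subset_of_pos (h : IsBary t w x) (hs : ∀ p ∈ s, 0 < w p) : s ⊆ t := by
  intro p hp
  by_contra hn
  exact (hs p hp).ne' (h.zero p hn)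

/-- Moving weights along an affine dependence until one of the weights vanishes. -/
theorem IsBary.exists_sub_mul [DecidableEq E] {μ : E → ℝ} (hw : IsBary s w x)
    (h0 : ∑ p ∈ s, μ p = 0) (h1 : ∑ p ∈ s, μ p • p = 0) (hoff : ∀ p, p ∉ s → μ p = 0)
    (hpos : ∃ q ∈ s, 0 < μ q) :
    ∃ r : ℝ, 0 ≤ r ∧ ∃ q ∈ s, 0 < μ q ∧ IsBary (s.erase q) (fun p => w p - r * μ p) x := by
  obtain ⟨q₀, hq₀, hμ₀⟩ := hpos
  -- Ratio test: the least `w p / μ p` over positive `μ p` is the first time at which a weight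
  -- reaches zero.
  obtain ⟨q, hq, hmin⟩ := Finset.exists_min_image (s.filter fun p => 0 < μ p) (fun p => w p / μ p)
    ⟨q₀, Finset.mem_filter.2 ⟨hq₀, hμ₀⟩⟩
  obtain ⟨hqs, hμ⟩ := Finset.mem_filter.1 hq
  have hr : 0 ≤ w q / μ q := div_nonneg (hw.nonneg q) hμ.le
  refine ⟨w q / μ q, hr, q, hqs, hμ, ?_⟩
  have hb : IsBary s (fun p => w p - w q / μ q * μ p) x := by
    refine ⟨fun p => ?_, fun p hp => ?_, ?_, ?_⟩
    · rcases lt_or_ge 0 (μ p) with hp | hp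
      · have hps : p ∈ s := by
          by_contra hn
          exact hp.ne' (hoff p hn)
        have := hmin p (Finset.mem_filter.2 ⟨hps, hp⟩)
        rw [le_div_iff₀ hp] at this
        exact sub_nonneg.2 this
      · have := mul_nonpos_of_nonneg_of_nonpos hr hp
        have := hw.nonneg p
        linarith
    · rw [hw.zero p hp, hoff p hp, mul_zero, sub_zero]
    · rw [Finset.sum_sub_distrib, ← Finset.mul_sum, h0, hw.sum, mul_zero, sub_zero]
    · simp only [sub_smul, mul_smul]
      rw [Finset.sum_sub_distrib, ← Finset.smul_sum, h1, hw.comb, smul_zero, sub_zero]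
  refine hb.restrict (Finset.erase_subset _ _) fun p hp => ?_
  by_cases hps : p ∈ s
  · have : p = q := by
      by_contra hne
      exact hp (Finset.mem_erase.2 ⟨hne, hps⟩)
    subst this
    rw [div_mul_cancel₀ _ hμ.ne', sub_self]
  · exact hb.zero p hps

/-- `w` is the system of barycentric coordinates of `x` in some simplex of `K`. -/
def IsRep (K : Geometry.SimplicialComplex ℝ E) (w : E → ℝ) (x : E) : Prop :=
  ∃ σ ∈ K.faces, IsBary σ w x

variable {K : Geometry.SimplicialComplex ℝ E}

/-- Two simplices carrying `x` meet in the hull of their common vertices; by affine independence,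
both coordinate systems equal the one on that hull. -/
theorem IsRep.unique (hw : IsRep K w x) (hv : IsRep K v x) : w = v := by
  classical
  obtain ⟨σ, hσ, hw⟩ := hw
  obtain ⟨τ, hτ, hv⟩ := hv
  have := K.inter_subset_convexHull hσ hτ ⟨hw.mem_convexHull, hv.mem_convexHull⟩
  rw [← Finset.coe_inter, mem_convexHull_iff_exists_isBary] at this
  obtain ⟨u, hu⟩ := this
  rw [hw.unique (K.indep hσ) (hu.mono Finset.inter_subset_left),
    hv.unique (K.indep hτ) (hu.mono Finset.inter_subset_right)]

theorem IsTriangulation.exists_isRep {P : Finset E} (hK : IsTriangulation P K)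
    (hx : x ∈ convexHull ℝ (P : Set E)) : ∃ w, IsRep K w x := by
  rw [← hK.space_eq, Geometry.SimplicialComplex.mem_space_iff] at hx
  obtain ⟨σ, hσ, hx⟩ := hx
  obtain ⟨w, hw⟩ := mem_convexHull_iff_exists_isBary.1 hx
  exact ⟨w, σ, hσ, hw⟩

theorem IsTriangulation.isBary {P : Finset E} (hK : IsTriangulation P K) (h : IsRep K w x) :
    IsBary P w x := by
  obtain ⟨σ, hσ, h⟩ := h
  exact h.mono (hK.subset σ hσ)

theorem affineIndependent_coe_iff_not_finrank_le {n : ℕ} (hs : s.card = n + 2) :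
    AffineIndependent ℝ ((↑) : s → E) ↔
      ¬ Module.finrank ℝ (vectorSpan ℝ (s : Set E)) ≤ n := by
  have key : ∀ S : Set E, S = Set.range ((↑) : s → E) →
      (AffineIndependent ℝ ((↑) : s → E) ↔ ¬ Module.finrank ℝ (vectorSpan ℝ S) ≤ n) := by
    rintro _ rfl
    exact affineIndependent_iff_not_finrank_vectorSpan_le ℝ _ (by simpa using hs)
  exact key _ Subtype.range_coe.symm

end Bary

/-! ### Weights and heights of lifted points -/

section Lift

variable {ω : Plane → ℝ} {s : Finset Plane} {w : Plane → ℝ}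

theorem proj_lift (p : Plane) : proj (lift ω p) = p := by
  ext i
  fin_cases i <;> rfl

theorem lift_two (p : Plane) : (lift ω p) 2 = ω p := rfl

theorem sum_smul_lift_eq_iff {y : Space} :
    ∑ p ∈ s, w p • lift ω p = y ↔ ∑ p ∈ s, w p • p = proj y ∧ ∑ p ∈ s, w p * ω p = y 2 := by
  have h0 : (∑ p ∈ s, w p • lift ω p) 0 = (∑ p ∈ s, w p • p) 0 := by
    simp only [WithLp.ofLp_sum, Finset.sum_apply]
    rfl
  have h1 : (∑ p ∈ s, w p • lift ω p) 1 = (∑ p ∈ s, w p • p) 1 := by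
    simp only [WithLp.ofLp_sum, Finset.sum_apply]
    rfl
  have h2 : (∑ p ∈ s, w p • lift ω p) 2 = ∑ p ∈ s, w p * ω p := by
    simp only [WithLp.ofLp_sum, Finset.sum_apply]
    rfl
  constructor
  · rintro rfl
    refine ⟨?_, h2.symm⟩
    ext i
    fin_cases i
    exacts [h0.symm, h1.symm]
  · rintro ⟨ha, hb⟩
    ext i
    fin_cases i
    · exact h0.trans (congrArg (fun x : Plane => x 0) ha)
    · exact h1.trans (congrArg (fun x : Plane => x 1) ha)
    · exact h2.trans hb

theorem mem_convexHull_lifted_iff {y : Space} :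
    y ∈ convexHull ℝ (lifted ω s : Set Space) ↔
      ∃ w, IsBary s w (proj y) ∧ ∑ p ∈ s, w p * ω p = y 2 := by
  constructor
  · intro h
    obtain ⟨v, h0, h1, h2⟩ := Finset.mem_convexHull'.1 h
    rw [lifted, Finset.sum_map] at h1 h2
    obtain ⟨ha, hb⟩ := sum_smul_lift_eq_iff.1 h2
    have hx : proj y ∈ convexHull ℝ (s : Set Plane) := Finset.mem_convexHull'.2
      ⟨fun p => v (lift ω p), fun p hp => h0 _ (Finset.mem_map_of_mem _ hp), h1, ha⟩
    classical
    refine ⟨fun p => if p ∈ s then v (lift ω p) else 0,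
      ⟨fun p => ?_, fun p hp => if_neg hp, ?_, ?_⟩, ?_⟩
    · split_ifs with hp
      exacts [h0 _ (Finset.mem_map_of_mem _ hp), le_rfl]
    · rw [← h1]; exact Finset.sum_congr rfl fun p hp => if_pos hp
    · rw [← ha]; exact Finset.sum_congr rfl fun p hp => by rw [if_pos hp]
    · rw [← hb]; exact Finset.sum_congr rfl fun p hp => congrArg (· * ω p) (if_pos hp)
  · rintro ⟨w, hw, h2⟩
    rw [← sum_smul_lift_eq_iff.2 ⟨hw.comb, h2⟩]
    exact (convex_convexHull ℝ _).sum_mem (fun p _ => hw.nonneg p) hw.sum fun p hp =>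
      subset_convexHull ℝ _ (Finset.mem_coe.2 (Finset.mem_map_of_mem _ hp))

theorem affineIndependent_lifted_iff :
    AffineIndependent ℝ ((↑) : lifted ω s → Space) ↔ ∀ w : Plane → ℝ, ∑ p ∈ s, w p = 0 →
      ∑ p ∈ s, w p • p = 0 → ∑ p ∈ s, w p * ω p = 0 → ∀ p ∈ s, w p = 0 := by
  have hz : proj 0 = 0 := by
    ext i
    fin_cases i <;> rfl
  rw [affineIndependent_coe_iff]
  constructor
  · intro h w h0 h1 h2 p hp
    have hinv : ∀ q, (w ∘ proj) (lift ω q) = w q := fun q => by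
      rw [Function.comp_apply, proj_lift]
    have := h (w ∘ proj) (by rw [lifted, Finset.sum_map]; simpa only [hinv] using h0)
      (by
        rw [lifted, Finset.sum_map]
        simp only [hinv]
        exact sum_smul_lift_eq_iff.2 ⟨h1.trans hz.symm, h2⟩)
      (lift ω p) (Finset.mem_map_of_mem _ hp)
    rwa [hinv] at this
  · intro h v h0 h1 y hy
    rw [lifted, Finset.sum_map] at h0 h1
    obtain ⟨p, hp, rfl⟩ := Finset.mem_map.1 hy
    obtain ⟨ha, hb⟩ := sum_smul_lift_eq_iff.1 h1
    exact h (fun p => v (lift ω p)) h0 (ha.trans hz) hb p hp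

theorem sum_mul_affineMap (h : Plane →ᵃ[ℝ] ℝ) :
    ∑ p ∈ s, w p * h p = h.linear (∑ p ∈ s, w p • p) + (∑ p ∈ s, w p) * h 0 := by
  rw [map_sum, Finset.sum_mul, ← Finset.sum_add_distrib]
  refine Finset.sum_congr rfl fun p _ => ?_
  rw [map_smul, smul_eq_mul, ← mul_add]
  congr 1
  exact congrFun h.decomp p

theorem IsBary.sum_mul_affineMap {x : Plane} (hw : IsBary s w x) (h : Plane →ᵃ[ℝ] ℝ) :
    ∑ p ∈ s, w p * h p = h x := by
  rw [FlipTriangulation.sum_mul_affineMap, hw.comb, hw.sum, one_mul]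
  exact (congrFun h.decomp x).symm

theorem exists_affineMap_eqOn (hs : s.card = 3) (hi : AffineIndependent ℝ ((↑) : s → Plane))
    (ω : Plane → ℝ) : ∃ h : Plane →ᵃ[ℝ] ℝ, ∀ p ∈ s, h p = ω p := by
  classical
  have ht : affineSpan ℝ (Set.range ((↑) : s → Plane)) = ⊤ :=
    hi.affineSpan_eq_top_iff_card_eq_finrank_add_one.2 (by simp [hs])
  let b : AffineBasis s ℝ Plane := ⟨(↑), hi, ht⟩
  refine ⟨∑ i : s, ω i • b.coord i, fun p hp => ?_⟩
  have hb : b ⟨p, hp⟩ = p := rfl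
  have he : (∑ i : s, ω i • b.coord i : Plane →ᵃ[ℝ] ℝ) p = ∑ i : s, ω i * b.coord i p := by
    induction (Finset.univ : Finset s) using Finset.induction_on with
    | empty => simp
    | insert a t ha ih => rw [Finset.sum_insert ha, Finset.sum_insert ha, ← ih]; rfl
  rw [he, Finset.sum_eq_single (⟨p, hp⟩ : s)]
  · have := b.coord_apply_eq ⟨p, hp⟩
    rw [hb] at this
    rw [this, mul_one]
  · intro i _ hi
    have := b.coord_apply_ne hi
    rw [hb] at this
    rw [this, mul_zero]
  · exact fun h => absurd (Finset.mem_univ _) h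

end Lift

/-! ### The affine dependence and the faces of a lifted tetrahedron -/

section Tetrahedron

variable {ω : Plane → ℝ} {A Q : Finset Plane}

theorem GeneralPosition.affineIndependent (hA : GeneralPosition A) {s : Finset Plane}
    (hs : s ⊆ A) (hc : s.card = 3) : AffineIndependent ℝ ((↑) : s → Plane) := by
  rw [affineIndependent_coe_iff_not_finrank_le (n := 1) hc, ← collinear_iff_finrank_le_one]
  exact hA s hs hc

theorem GenericHeight.affineIndependent (hω : GenericHeight ω A) {s : Finset Plane}
    (hs : s ⊆ A) (hc : s.card = 4) : AffineIndependent ℝ ((↑) : lifted ω s → Space) := by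
  rw [affineIndependent_coe_iff_not_finrank_le (n := 2) (by rw [lifted, Finset.card_map, hc]),
    ← coplanar_iff_finrank_le_two]
  exact hω s hs hc

/-- `μ` is an affine dependence of the plane point set `Q`, without zeros on `Q`, that
has positive total height. -/
structure IsDependence (ω : Plane → ℝ) (Q : Finset Plane) (μ : Plane → ℝ) : Prop where
  off : ∀ p, p ∉ Q → μ p = 0
  sum : ∑ p ∈ Q, μ p = 0
  comb : ∑ p ∈ Q, μ p • p = 0
  height : 0 < ∑ p ∈ Q, μ p * ω p
  ne_zero : ∀ p ∈ Q, μ p ≠ 0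

/-- Four points of the plane are dependent. A zero coefficient would make the other three collinear,
and zero total height would make the lifted points coplanar; a change of sign makes the height
positive. -/
theorem exists_isDependence (hA : GeneralPosition A) (hω : GenericHeight ω A) (hQ : Q ⊆ A)
    (hc : Q.card = 4) : ∃ μ, IsDependence ω Q μ := by
  classical
  have hn : ¬ AffineIndependent ℝ ((↑) : Q → Plane) := by
    rw [affineIndependent_coe_iff_not_finrank_le (n := 2) hc, not_not]
    exact (Submodule.finrank_le _).trans (by simp)
  obtain ⟨f, h1, h0, p, hp, hne⟩ := exists_nontrivial_relation_sum_zero_of_not_affine_ind hn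
  have hz : ∀ q ∈ Q, f q ≠ 0 := by
    intro q hq hfq
    have hce : (Q.erase q).card = 3 := by rw [Finset.card_erase_of_mem hq, hc]
    have hi := hA.affineIndependent ((Finset.erase_subset q Q).trans hQ) hce
    refine hne (affineIndependent_coe_iff.1 hi f ?_ ?_ p (Finset.mem_erase.2 ⟨?_, hp⟩))
    · rw [← h0]
      exact Finset.sum_erase _ hfq
    · rw [← h1]
      exact Finset.sum_erase _ (by rw [hfq, zero_smul])
    · rintro rfl
      exact hne hfq
  have key : ∀ g : Plane → ℝ, ∑ p ∈ Q, g p = 0 → ∑ p ∈ Q, g p • p = 0 →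
      0 < ∑ p ∈ Q, g p * ω p → (∀ p ∈ Q, g p ≠ 0) → ∃ μ, IsDependence ω Q μ := by
    intro g g0 g1 g2 g3
    refine ⟨fun p => if p ∈ Q then g p else 0, fun p hp => if_neg hp, ?_, ?_, ?_, fun p hp => ?_⟩
    · rw [← g0]; exact Finset.sum_congr rfl fun p hp => if_pos hp
    · rw [← g1]; exact Finset.sum_congr rfl fun p hp => by rw [if_pos hp]
    · refine g2.trans_eq (Finset.sum_congr rfl fun p hp => ?_)
      rw [if_pos hp]
    · rw [if_pos hp]; exact g3 p hp
  rcases lt_trichotomy (∑ p ∈ Q, f p * ω p) 0 with h | h | h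
  · refine key (fun p => -f p) ?_ ?_ ?_ fun p hp => neg_ne_zero.2 (hz p hp)
    · rw [Finset.sum_neg_distrib, h0, neg_zero]
    · simp only [neg_smul]
      rw [Finset.sum_neg_distrib, h1, neg_zero]
    · simp only [neg_mul]
      rw [Finset.sum_neg_distrib]
      exact neg_pos.2 h
  · exact absurd (affineIndependent_lifted_iff.1 (hω.affineIndependent hQ hc) f h0 h1 h p hp) hne
  · exact key f h0 h1 h hz

namespace IsDependence

variable {μ : Plane → ℝ}

theorem nonempty (h : IsDependence ω Q μ) : Q.Nonempty := by
  by_contra hn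
  rw [Finset.not_nonempty_iff_eq_empty] at hn
  subst hn
  simpa using h.height

theorem exists_pos (h : IsDependence ω Q μ) : ∃ q ∈ Q, 0 < μ q := by
  by_contra! hn
  obtain ⟨q, hq⟩ := h.nonempty
  exact h.ne_zero q hq ((Finset.sum_eq_zero_iff_of_nonpos hn).1 h.sum q hq)

theorem exists_neg (h : IsDependence ω Q μ) : ∃ q ∈ Q, μ q < 0 := by
  by_contra! hn
  obtain ⟨q, hq⟩ := h.nonempty
  exact h.ne_zero q hq ((Finset.sum_eq_zero_iff_of_nonneg hn).1 h.sum q hq)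

/-- The difference in height between a vertex and the plane through the other three. -/
theorem mul_sub_pos (hμ : IsDependence ω Q μ) {q : Plane} (hq : q ∈ Q) {h : Plane →ᵃ[ℝ] ℝ}
    (hh : ∀ p ∈ Q.erase q, h p = ω p) : 0 < μ q * (ω q - h q) := by
  have h1 : ∑ p ∈ Q, μ p * h p = 0 := by
    rw [sum_mul_affineMap, hμ.comb, hμ.sum, map_zero, zero_mul, add_zero]
  have h2 : ∑ p ∈ Q, μ p * (ω p - h p) = μ q * (ω q - h q) := by
    refine Finset.sum_eq_single_of_mem q hq fun p hp hne => ?_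
    rw [hh p (Finset.mem_erase.2 ⟨hne, hp⟩), sub_self, mul_zero]
  rw [← h2]
  simp only [mul_sub]
  rw [Finset.sum_sub_distrib, h1, sub_zero]
  exact hμ.height

end IsDependence

theorem not_collinear_lifted_erase (hω : GenericHeight ω A) (hQ : Q ⊆ A) (hc : Q.card = 4)
    {q : Plane} (hq : q ∈ Q) : ¬ Collinear ℝ (lifted ω (Q.erase q) : Set Space) := by
  have hce : (lifted ω (Q.erase q)).card = 3 := by
    rw [lifted, Finset.card_map, Finset.card_erase_of_mem hq, hc]
  rw [collinear_iff_finrank_le_one, ← affineIndependent_coe_iff_not_finrank_le (n := 1) hce]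
  exact (hω.affineIndependent hQ hc).mono
    (Finset.coe_subset.2 (Finset.map_subset_map.2 (Finset.erase_subset q Q)))

theorem mem_lifted_iff {s : Finset Plane} {p : Plane} : lift ω p ∈ lifted ω s ↔ p ∈ s :=
  Finset.mem_map' _

/-- By `IsDependence.mul_sub_pos`, a vertex with positive coefficient lies above the plane through
the other three; a negative coefficient puts it below. -/
theorem isLowerFace_erase (hA : GeneralPosition A) (hω : GenericHeight ω A) (hQ : Q ⊆ A)
    (hc : Q.card = 4) {μ : Plane → ℝ} (hμ : IsDependence ω Q μ) {q : Plane} (hq : q ∈ Q)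
    (hpos : 0 < μ q) : IsLowerFace (lifted ω Q) (lifted ω (Q.erase q)) := by
  have hce : (Q.erase q).card = 3 := by rw [Finset.card_erase_of_mem hq, hc]
  obtain ⟨h, hh⟩ := exists_affineMap_eqOn hce
    (hA.affineIndependent ((Finset.erase_subset q Q).trans hQ) hce) ω
  have hlt : h q < ω q := sub_pos.1 (pos_of_mul_pos_right (hμ.mul_sub_pos hq hh) hpos.le)
  refine ⟨Finset.map_subset_map.2 (Finset.erase_subset q Q),
    not_collinear_lifted_erase hω hQ hc hq, h, fun x hx => ?_⟩
  obtain ⟨p, hp, rfl⟩ := Finset.mem_map.1 hx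
  rw [proj_lift, lift_two, mem_lifted_iff]
  by_cases hpq : p = q
  · subst hpq
    exact ⟨hlt.le, by simp [hlt.ne]⟩
  · have hm := Finset.mem_erase.2 ⟨hpq, hp⟩
    exact ⟨(hh p hm).le, by simp only [hm, hh p hm]⟩

theorem isUpperFace_erase (hA : GeneralPosition A) (hω : GenericHeight ω A) (hQ : Q ⊆ A)
    (hc : Q.card = 4) {μ : Plane → ℝ} (hμ : IsDependence ω Q μ) {q : Plane} (hq : q ∈ Q)
    (hneg : μ q < 0) : IsUpperFace (lifted ω Q) (lifted ω (Q.erase q)) := by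
  have hce : (Q.erase q).card = 3 := by rw [Finset.card_erase_of_mem hq, hc]
  obtain ⟨h, hh⟩ := exists_affineMap_eqOn hce
    (hA.affineIndependent ((Finset.erase_subset q Q).trans hQ) hce) ω
  have hlt : ω q < h q := sub_neg.1 (neg_of_mul_pos_right (hμ.mul_sub_pos hq hh) hneg.le)
  refine ⟨Finset.map_subset_map.2 (Finset.erase_subset q Q),
    not_collinear_lifted_erase hω hQ hc hq, h, fun x hx => ?_⟩
  obtain ⟨p, hp, rfl⟩ := Finset.mem_map.1 hx
  rw [proj_lift, lift_two, mem_lifted_iff]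
  by_cases hpq : p = q
  · subst hpq
    exact ⟨hlt.le, by simp [hlt.ne']⟩
  · have hm := Finset.mem_erase.2 ⟨hpq, hp⟩
    exact ⟨(hh p hm).ge, by simp only [hm, hh p hm]⟩

/-- The height over `A` of the point with weights `w`. -/
def height (ω : Plane → ℝ) (A : Finset Plane) (w : Plane → ℝ) : ℝ := ∑ p ∈ A, w p * ω p

theorem height_eq_sum {s : Finset Plane} {w : Plane → ℝ} (hs : s ⊆ A)
    (hw : ∀ p, p ∉ s → w p = 0) : height ω A w = ∑ p ∈ s, w p * ω p :=
  (Finset.sum_subset hs fun p _ hp => by rw [hw p hp, zero_mul]).symm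

theorem height_sub_mul (w μ : Plane → ℝ) (r : ℝ) :
    height ω A (fun p => w p - r * μ p) = height ω A w - r * height ω A μ := by
  simp only [height, sub_mul, mul_assoc]
  rw [Finset.sum_sub_distrib, ← Finset.mul_sum]

/-- `T₂` arises from `T₁` by replacing the lower faces of a tetrahedron by its upper faces. -/
structure IsUpStep (ω : Plane → ℝ) (A Q : Finset Plane)
    (T₁ T₂ : Geometry.SimplicialComplex ℝ Plane) : Prop where
  left : IsTriangulation A T₁
  right : IsTriangulation A T₂
  subset : Q ⊆ A
  card : Q.card = 4
  lower : ∀ s : Finset Plane, IsLowerFace (lifted ω Q) (lifted ω s) → s ∈ T₁.faces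
  upper : ∀ s : Finset Plane, IsUpperFace (lifted ω Q) (lifted ω s) → s ∈ T₂.faces
  agree : ∀ x ∈ convexHull ℝ (A : Set Plane), x ∉ convexHull ℝ (Q : Set Plane) →
    ∃ w, IsRep T₁ w x ∧ IsRep T₂ w x

/-! ### The effect of one step on the surface -/

section Flip

variable {T₁ T₂ : Geometry.SimplicialComplex ℝ Plane}

/-- A simplex of `T₁` carrying a point outside `conv Q` cannot belong to the removed triangulation
of `Q`, so it survives the flip. -/
theorem IsFlip.exists_isRep (h : IsFlip A Q T₁ T₂) {x : Plane}
    (hxA : x ∈ convexHull ℝ (A : Set Plane)) (hx : x ∉ convexHull ℝ (Q : Set Plane)) :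
    ∃ w, IsRep T₁ w x ∧ IsRep T₂ w x := by
  obtain ⟨h₁, -, -, -, S₁, S₂, hS₁, -, -, -, hf⟩ := h
  obtain ⟨w, σ, hσ, hw⟩ := h₁.exists_isRep hxA
  refine ⟨w, ⟨σ, hσ, hw⟩, σ, ?_, hw⟩
  rw [hf]
  refine Or.inl ⟨hσ, fun hS => hx ?_⟩
  rw [← hS₁.space_eq]
  exact Geometry.SimplicialComplex.convexHull_subset_space hS hw.mem_convexHull

theorem IsUpFlip.isUpStep (h : IsUpFlip ω A Q T₁ T₂) : IsUpStep ω A Q T₁ T₂ where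
  left := h.1.1
  right := h.1.2.1
  subset := h.1.2.2.1
  card := h.1.2.2.2.1
  lower := h.2.1
  upper := h.2.2
  agree _ hxA hx := h.1.exists_isRep hxA hx

theorem IsDownFlip.isUpStep (h : IsDownFlip ω A Q T₁ T₂) : IsUpStep ω A Q T₂ T₁ where
  left := h.1.2.1
  right := h.1.1
  subset := h.1.2.2.1
  card := h.1.2.2.2.1
  lower := h.2.2
  upper := h.2.1
  agree _ hxA hx := (h.1.exists_isRep hxA hx).imp fun _ hw => hw.symm

namespace IsUpStep

variable {x : Plane} {u v w : Plane → ℝ}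

/-- Slide down along the dependence until the weight of some `q` with positive coefficient vanishes.
The remaining three points span a lower face, which is in `T₁`, so uniqueness identifies the result
with `u`. The height drops unless the slide has length zero. -/
theorem lower_rep (h : IsUpStep ω A Q T₁ T₂) (hA : GeneralPosition A) (hω : GenericHeight ω A)
    (hw : IsBary Q w x) (hu : IsRep T₁ u x) :
    IsBary Q u x ∧ (u = w ∨ height ω A u < height ω A w) := by
  classical
  obtain ⟨μ, hμ⟩ := exists_isDependence hA hω h.subset h.card
  obtain ⟨r, hr, q, hq, hqμ, hb⟩ := hw.exists_sub_mul hμ.sum hμ.comb hμ.off hμ.exists_pos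
  have hu' := hu.unique ⟨_, h.lower _ (isLowerFace_erase hA hω h.subset h.card hμ hq hqμ), hb⟩
  refine ⟨by rw [hu']; exact hb.mono (Finset.erase_subset q Q), ?_⟩
  rcases hr.eq_or_lt with rfl | hr
  · left
    rw [hu']
    funext p
    rw [zero_mul, sub_zero]
  · right
    have hμh := hμ.height
    rw [← height_eq_sum h.subset hμ.off] at hμh
    rw [hu', height_sub_mul]
    exact sub_lt_self _ (mul_pos hr hμh)

theorem upper_rep (h : IsUpStep ω A Q T₁ T₂) (hA : GeneralPosition A) (hω : GenericHeight ω A)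
    (hw : IsBary Q w x) (hu : IsRep T₂ u x) :
    IsBary Q u x ∧ (w = u ∨ height ω A w < height ω A u) := by
  classical
  obtain ⟨μ, hμ⟩ := exists_isDependence hA hω h.subset h.card
  have hneg : ∃ q ∈ Q, 0 < -μ q := hμ.exists_neg.imp fun q hq => ⟨hq.1, neg_pos.2 hq.2⟩
  obtain ⟨r, hr, q, hq, hqμ, hb⟩ := hw.exists_sub_mul (μ := fun p => -μ p)
    (by rw [Finset.sum_neg_distrib, hμ.sum, neg_zero])
    (by simp only [neg_smul]; rw [Finset.sum_neg_distrib, hμ.comb, neg_zero])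
    (fun p hp => by rw [hμ.off p hp, neg_zero]) hneg
  have hu' := hu.unique
    ⟨_, h.upper _ (isUpperFace_erase hA hω h.subset h.card hμ hq (neg_pos.1 hqμ)), hb⟩
  refine ⟨by rw [hu']; exact hb.mono (Finset.erase_subset q Q), ?_⟩
  rcases hr.eq_or_lt with rfl | hr
  · left
    rw [hu']
    funext p
    rw [zero_mul, sub_zero]
  · right
    have hμh := hμ.height
    rw [← height_eq_sum h.subset hμ.off] at hμh
    have hh : (fun p => w p - r * -μ p) = fun p => w p - (-r) * μ p := by
      funext p
      ring
    rw [hu', hh, height_sub_mul, neg_mul, sub_neg_eq_add]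
    exact lt_add_of_pos_right _ (mul_pos hr hμh)

/-- Over `conv Q` the point of the `T₂` surface lies in the tetrahedron, so the downward slide can
start there and ends on the `T₁` surface. -/
theorem eq_or_isBary (h : IsUpStep ω A Q T₁ T₂) (hA : GeneralPosition A)
    (hω : GenericHeight ω A) (hu : IsRep T₁ u x) (hv : IsRep T₂ v x) :
    u = v ∨ height ω A u < height ω A v ∧ IsBary Q u x ∧ IsBary Q v x := by
  by_cases hx : x ∈ convexHull ℝ (Q : Set Plane)
  · obtain ⟨w, hw⟩ := mem_convexHull_iff_exists_isBary.1 hx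
    have hv' := (h.upper_rep hA hω hw hv).1
    obtain ⟨hu', he⟩ := h.lower_rep hA hω hv' hu
    exact he.imp id fun hlt => ⟨hlt, hu', hv'⟩
  · obtain ⟨w, hw₁, hw₂⟩ := h.agree x (h.left.isBary hu).mem_convexHull hx
    exact Or.inl ((hu.unique hw₁).trans (hw₂.unique hv))

/-- A proper face of the tetrahedron of a step is a face of a lower or of an upper triangle. -/
theorem mem_faces_of_ssubset (h : IsUpStep ω A Q T₁ T₂) (hA : GeneralPosition A)
    (hω : GenericHeight ω A) {σ : Finset Plane} (hσ : σ.Nonempty) (hσQ : σ ⊂ Q) :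
    σ ∈ T₁.faces ∨ σ ∈ T₂.faces := by
  classical
  obtain ⟨μ, hμ⟩ := exists_isDependence hA hω h.subset h.card
  obtain ⟨q, hq, hqσ⟩ := Finset.exists_of_ssubset hσQ
  have hs : σ ⊆ Q.erase q := Finset.subset_erase.2 ⟨hσQ.1, hqσ⟩
  rcases (hμ.ne_zero q hq).lt_or_gt with hlt | hgt
  · exact Or.inr (T₂.down_closed
      (h.upper _ (isUpperFace_erase hA hω h.subset h.card hμ hq hlt)) hs hσ)
  · exact Or.inl (T₁.down_closed
      (h.lower _ (isLowerFace_erase hA hω h.subset h.card hμ hq hgt)) hs hσ)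

end IsUpStep

end Flip

end Tetrahedron

variable {ω : Plane → ℝ} {A : Finset Plane}

theorem IsBary.add_mul_sub {E : Type*} [AddCommGroup E] [Module ℝ E] {s : Finset E} {u v : E → ℝ}
    {x : E} (hu : IsBary s u x) (hv : IsBary s v x) {r : ℝ} (h0 : 0 ≤ r) (h1 : r ≤ 1) :
    IsBary s (fun p => u p + r * (v p - u p)) x where
  nonneg p := by
    have := mul_nonneg h0 (hv.nonneg p)
    have := mul_nonneg (sub_nonneg.2 h1) (hu.nonneg p)
    linarith
  zero p hp := by rw [hu.zero p hp, hv.zero p hp, sub_self, mul_zero, add_zero]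
  sum := by
    rw [Finset.sum_add_distrib, ← Finset.mul_sum, Finset.sum_sub_distrib, hu.sum, hv.sum, sub_self,
      mul_zero, add_zero]
  comb := by
    simp only [add_smul, mul_smul, sub_smul]
    rw [Finset.sum_add_distrib, ← Finset.smul_sum, Finset.sum_sub_distrib, hu.comb, hv.comb,
      sub_self, smul_zero, add_zero]

theorem mem_convexHull_lifted_of_height {s : Finset Plane} (hs : s ⊆ A) {w : Plane → ℝ} {y : Space}
    (hw : IsBary s w (proj y)) (hy : height ω A w = y 2) :
    y ∈ convexHull ℝ (lifted ω s : Set Space) :=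
  mem_convexHull_lifted_iff.2 ⟨w, hw, by rw [← height_eq_sum hs hw.zero, hy]⟩

theorem exists_height_of_mem_convexHull_lifted {s : Finset Plane} (hs : s ⊆ A) {y : Space}
    (hy : y ∈ convexHull ℝ (lifted ω s : Set Space)) :
    ∃ w, IsBary s w (proj y) ∧ height ω A w = y 2 := by
  obtain ⟨w, hw, h⟩ := mem_convexHull_lifted_iff.1 hy
  exact ⟨w, hw, by rw [height_eq_sum hs hw.zero, h]⟩

/-- The point with projection `x` and height `z` lies in the hull of a lifted set if its height
is between the heights of two points of that hull above `x`. -/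
theorem mem_convexHull_lifted_of_between {s : Finset Plane} (hs : s ⊆ A) {u v : Plane → ℝ}
    {y : Space} (hu : IsBary s u (proj y)) (hv : IsBary s v (proj y)) (h1 : height ω A u < y 2)
    (h2 : y 2 ≤ height ω A v) : y ∈ convexHull ℝ (lifted ω s : Set Space) := by
  have hd : 0 < height ω A v - height ω A u := by linarith
  refine mem_convexHull_lifted_of_height hs
    (hu.add_mul_sub hv (r := (y 2 - height ω A u) / (height ω A v - height ω A u))
      (div_nonneg (by linarith) hd.le) ((div_le_one hd).2 (by linarith))) ?_
  set r := (y 2 - height ω A u) / (height ω A v - height ω A u) with hr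
  have : height ω A (fun p => u p + r * (v p - u p)) =
      height ω A u + r * (height ω A v - height ω A u) := by
    simp only [height, add_mul, mul_assoc, sub_mul]
    rw [Finset.sum_add_distrib, ← Finset.mul_sum, Finset.sum_sub_distrib]
  rw [this, hr, div_mul_cancel₀ _ hd.ne']
  ring

/-! ### Monotone sequences of surfaces -/

section Sequence

variable {m : ℕ} {T : Fin (m + 1) → Geometry.SimplicialComplex ℝ Plane} {Q : Fin m → Finset Plane}
  {x : Plane} {u : Fin (m + 1) → Plane → ℝ} {v w : Plane → ℝ}

theorem rep_eq_or_height_lt (hA : GeneralPosition A) (hω : GenericHeight ω A)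
    (hT : ∀ i : Fin m, IsUpStep ω A (Q i) (T i.castSucc) (T i.succ))
    (hu : ∀ j, IsRep (T j) (u j) x) {i j : Fin (m + 1)} (hij : i ≤ j) :
    u i = u j ∨ height ω A (u i) < height ω A (u j) := by
  induction j using Fin.induction with
  | zero => exact Or.inl (by rw [Fin.le_zero_iff.1 hij])
  | succ k ih =>
    rcases hij.eq_or_lt with rfl | hlt
    · exact Or.inl rfl
    · have h1 := ih (Fin.le_castSucc_iff.2 hlt)
      have h2 := (hT k).eq_or_isBary hA hω (hu _) (hu _)
      rcases h1 with h1 | h1 <;> rcases h2 with h2 | ⟨h2, -⟩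
      · exact Or.inl (h1.trans h2)
      · exact Or.inr (by rwa [h1])
      · exact Or.inr (by rwa [← h2])
      · exact Or.inr (h1.trans h2)

theorem height_rep_mono (hA : GeneralPosition A) (hω : GenericHeight ω A)
    (hT : ∀ i : Fin m, IsUpStep ω A (Q i) (T i.castSucc) (T i.succ))
    (hu : ∀ j, IsRep (T j) (u j) x) {i j : Fin (m + 1)} (hij : i ≤ j) :
    height ω A (u i) ≤ height ω A (u j) := by
  rcases rep_eq_or_height_lt hA hω hT hu hij with h | h
  · rw [h]
  · exact h.le

/-- A common point of the tetrahedra of two steps has the same coordinates in both, and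
lies on the surface right above the first one. -/
theorem eq_and_isRep_of_height_eq (hA : GeneralPosition A) (hω : GenericHeight ω A)
    (htri : ∀ j, IsTriangulation A (T j))
    (hT : ∀ i : Fin m, IsUpStep ω A (Q i) (T i.castSucc) (T i.succ))
    {i j : Fin m} (hij : i < j) (hw : IsBary (Q i) w x) (hv : IsBary (Q j) v x)
    (he : height ω A w = height ω A v) : w = v ∧ IsRep (T i.succ) w x := by
  have hx : x ∈ convexHull ℝ (A : Set Plane) := (hw.mono (hT i).subset).mem_convexHull
  choose u hu using fun j => (htri j).exists_isRep hx
  have h1 := ((hT i).upper_rep hA hω hw (hu _)).2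
  have h2 := rep_eq_or_height_lt hA hω hT hu (Fin.le_castSucc_iff.2 (Fin.succ_lt_succ_iff.2 hij))
  have h3 := ((hT j).lower_rep hA hω hv (hu _)).2
  have key : ∀ {a b : Plane → ℝ}, a = b ∨ height ω A a < height ω A b →
      height ω A a ≤ height ω A b := fun {a b} h => h.elim (fun h => h ▸ le_rfl) le_of_lt
  have k1 := key h1
  have k2 := key h2
  have k3 := key h3
  -- The chain of weak inequalities begins and ends at the same height, so no link is strict.
  have e1 := h1.resolve_right (by linarith)
  have e2 := h2.resolve_right (by linarith)
  have e3 := h3.resolve_right (by linarith)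
  exact ⟨e1.trans (e2.trans e3), e1 ▸ hu i.succ⟩

theorem eq_of_height_eq (hA : GeneralPosition A) (hω : GenericHeight ω A)
    (htri : ∀ j, IsTriangulation A (T j))
    (hT : ∀ i : Fin m, IsUpStep ω A (Q i) (T i.castSucc) (T i.succ))
    {i j : Fin m} (hw : IsBary (Q i) w x) (hv : IsBary (Q j) v x)
    (he : height ω A w = height ω A v) : w = v := by
  rcases lt_trichotomy i j with hij | rfl | hij
  · exact (eq_and_isRep_of_height_eq hA hω htri hT hij hw hv he).1
  · have hi := affineIndependent_lifted_iff.1 (hω.affineIndependent (hT i).subset (hT i).card)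
    rw [height_eq_sum (hT i).subset hw.zero, height_eq_sum (hT i).subset hv.zero] at he
    funext p
    by_cases hp : p ∈ Q i
    · refine sub_eq_zero.1 (hi (fun p => w p - v p) ?_ ?_ ?_ p hp)
      · rw [Finset.sum_sub_distrib, hw.sum, hv.sum, sub_self]
      · simp only [sub_smul]
        rw [Finset.sum_sub_distrib, hw.comb, hv.comb, sub_self]
      · simp only [sub_mul]
        rw [Finset.sum_sub_distrib, he, sub_self]
    · rw [hw.zero p hp, hv.zero p hp]
  · exact (eq_and_isRep_of_height_eq hA hω htri hT hij hv hw he.symm).1.symm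

theorem card_le_three_of_mem_faces {K : Geometry.SimplicialComplex ℝ Plane} {σ : Finset Plane}
    (hσ : σ ∈ K.faces) : σ.card ≤ 3 := by
  have h1 := (K.indep hσ).card_le_finrank_succ
  have h2 : Module.finrank ℝ (vectorSpan ℝ (Set.range ((↑) : σ → Plane))) ≤ 2 :=
    (Submodule.finrank_le _).trans (by simp)
  rw [Fintype.card_coe] at h1
  exact h1.trans (Nat.succ_le_succ h2)

/-- If a support recurred, its centroid would have coordinates in a planar complex that are positive
at four points, but simplices there have at most three vertices. -/
theorem injective_of_isUpStep (hA : GeneralPosition A) (hω : GenericHeight ω A)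
    (htri : ∀ j, IsTriangulation A (T j))
    (hT : ∀ i : Fin m, IsUpStep ω A (Q i) (T i.castSucc) (T i.succ)) :
    Function.Injective Q := by
  have key : ∀ {i j : Fin m}, i < j → Q i ≠ Q j := by
    intro i j hij he
    obtain ⟨w, x, hw, hpos⟩ := isBary_uniform (s := Q i)
      (Finset.card_pos.1 (by rw [(hT i).card]; norm_num))
    obtain ⟨-, σ, hσ, hwσ⟩ :=
      eq_and_isRep_of_height_eq hA hω htri hT hij hw (he ▸ hw) rfl
    have h1 := Finset.card_le_card (hwσ.subset_of_pos hpos)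
    have h2 := card_le_three_of_mem_faces hσ
    have h3 := (hT i).card
    omega
  intro i j he
  rcases lt_trichotomy i j with hij | hij | hij
  exacts [absurd he (key hij), hij, absurd he.symm (key hij)]

/-- A point between the lowest and the highest surface lies in the tetrahedron of a step. -/
theorem exists_mem_convexHull_of_between (hA : GeneralPosition A) (hω : GenericHeight ω A)
    (hT : ∀ i : Fin m, IsUpStep ω A (Q i) (T i.castSucc) (T i.succ)) {y : Space}
    (hu : ∀ j, IsRep (T j) (u j) (proj y)) (h0 : height ω A (u 0) < y 2)
    (h1 : y 2 ≤ height ω A (u (Fin.last m))) :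
    ∃ i, y ∈ convexHull ℝ (lifted ω (Q i) : Set Space) := by
  by_contra! hn
  refine h1.not_gt ?_
  -- If no tetrahedron contains `y`, no step can carry the surface from below `y` to its height or
  -- above.
  have : ∀ j, height ω A (u j) < y 2 := by
    intro j
    induction j using Fin.induction with
    | zero => exact h0
    | succ k ih =>
      rcases (hT k).eq_or_isBary hA hω (hu _) (hu _) with h | ⟨-, ha, hb⟩
      · rwa [← h]
      · by_contra! hle
        exact hn k (mem_convexHull_lifted_of_between (hT k).subset ha hb ih hle)
  exact this _

/-- The lifted centroid of `σ` lies in some tetrahedron `i`. If no support contained `σ`, no step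
could create or destroy its coordinates `w`; they would persist through every `T k`, in particular
just before step `i`, where `lower_rep` forces `σ ⊆ Q i`. -/
theorem exists_subset_of_mem_faces (hA : GeneralPosition A) (hω : GenericHeight ω A)
    (htri : ∀ j, IsTriangulation A (T j))
    (hT : ∀ i : Fin m, IsUpStep ω A (Q i) (T i.castSucc) (T i.succ))
    (hun : convexHull ℝ (lifted ω A : Set Space) ⊆
      ⋃ i : Fin m, convexHull ℝ (lifted ω (Q i) : Set Space))
    {j : Fin (m + 1)} {σ : Finset Plane} (hσ : σ ∈ (T j).faces) : ∃ i, σ ⊆ Q i := by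
  obtain ⟨w, x, hw, hpos⟩ := isBary_uniform ((T j).nonempty_of_mem_faces hσ)
  have hwA := hw.mono ((htri j).subset σ hσ)
  choose u hu using fun j => (htri j).exists_isRep hwA.mem_convexHull
  have huj : u j = w := (hu j).unique ⟨σ, hσ, hw⟩
  obtain ⟨hx, h2⟩ := sum_smul_lift_eq_iff.1 (rfl : ∑ p ∈ A, w p • lift ω p = _)
  rw [hwA.comb] at hx
  obtain ⟨i, hi⟩ := Set.mem_iUnion.1 (hun (mem_convexHull_lifted_iff.2 ⟨w, hx ▸ hwA, h2⟩))
  obtain ⟨w', hw', -⟩ := mem_convexHull_lifted_iff.1 hi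
  rw [← hx] at hw'
  by_contra! hn
  have hiff : ∀ k : Fin m, u k.castSucc = w ↔ u k.succ = w := by
    intro k
    rcases (hT k).eq_or_isBary hA hω (hu _) (hu _) with h | ⟨-, ha, hb⟩
    · rw [h]
    · constructor
      · intro h
        exact absurd ((h ▸ ha).subset_of_pos hpos) (hn k)
      · intro h
        exact absurd ((h ▸ hb).subset_of_pos hpos) (hn k)
  have hall : ∀ k, u k = w ↔ u 0 = w := by
    intro k
    induction k using Fin.induction with
    | zero => exact Iff.rfl
    | succ k ih => exact (hiff k).symm.trans ih
  have huw : u i.castSucc = w := (hall _).2 ((hall j).1 huj)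
  have := ((hT i).lower_rep hA hω hw' (hu _)).1
  rw [huw] at this
  exact hn i (this.subset_of_pos hpos)

end Sequence

/-! ### Generic points and the bottom and top of the hull -/

section Hull

/-- The points in the vertical planes through at most two points of `A`. -/
def thin (A : Finset Plane) : Set Space :=
  {y | ∃ s ⊆ A, s.card ≤ 2 ∧ proj y ∈ affineSpan ℝ (s : Set Plane)}

/-- The canonical projection as a linear map. -/
def projLinear : Space →ₗ[ℝ] Plane where
  toFun := proj
  map_add' x y := by
    ext i
    fin_cases i <;> rfl
  map_smul' r x := by
    ext i
    fin_cases i <;> rfl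

theorem affineSpan_ne_top_of_card_le_two {s : Finset Plane} (hs : s.card ≤ 2) :
    affineSpan ℝ (s : Set Plane) ≠ ⊤ := by
  intro h
  have h1 : vectorSpan ℝ (s : Set Plane) = ⊤ := by
    rw [← direction_affineSpan, h, AffineSubspace.direction_top]
  have h2 := collinear_iff_finrank_le_one (k := ℝ) (s := (s : Set Plane))
  rw [h1, finrank_top, finrank_euclideanSpace_fin] at h2
  refine absurd (h2.1 ?_) (by norm_num)
  rcases Nat.lt_or_ge s.card 2 with hlt | hge
  · rcases Finset.card_le_one_iff_subset_singleton.1 (Nat.lt_succ_iff.1 hlt) with ⟨p, hp⟩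
    exact (collinear_singleton ℝ p).subset (by exact_mod_cast hp)
  · obtain ⟨p, q, -, rfl⟩ := Finset.card_eq_two.1 (le_antisymm hs hge)
    simpa using collinear_pair ℝ p q

theorem volume_thin (A : Finset Plane) : MeasureTheory.volume (thin A) = 0 := by
  have hsub : thin A ⊆ ⋃ s ∈ (A.powerset.filter fun s => s.card ≤ 2 : Finset (Finset Plane)),
      (((affineSpan ℝ (s : Set Plane)).comap projLinear.toAffineMap : AffineSubspace ℝ Space) :
        Set Space) := by
    rintro y ⟨s, hsA, hc, hy⟩
    exact Set.mem_biUnion (Finset.mem_coe.2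
      (Finset.mem_filter.2 ⟨Finset.mem_powerset.2 hsA, hc⟩)) hy
  refine MeasureTheory.measure_mono_null hsub ((MeasureTheory.measure_biUnion_null_iff
    (Finset.countable_toSet _)).2 fun s hs => MeasureTheory.Measure.addHaar_affineSubspace _ _ ?_)
  intro h
  refine affineSpan_ne_top_of_card_le_two (Finset.mem_filter.1 hs).2 ?_
  refine SetLike.ext fun p => iff_of_true ?_ (AffineSubspace.mem_top ..)
  -- `lift 0` is a section of the projection, so a preimage equal to all of space forces the span to
  -- be the whole plane.
  have : lift 0 p ∈ (affineSpan ℝ (s : Set Plane)).comap projLinear.toAffineMap := by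
    rw [h]; exact AffineSubspace.mem_top ..
  have h' : proj (lift 0 p) ∈ affineSpan ℝ (s : Set Plane) := this
  rwa [proj_lift] at h'

/-- Regularity is a condition on triangles only; off `thin A` the simplex carrying the projection is
a triangle, and density recovers the other points. -/
theorem dense_compl_thin (A : Finset Plane) : Dense (thin A)ᶜ :=
  MeasureTheory.Measure.dense_of_ae (μ := MeasureTheory.volume)
    (MeasureTheory.compl_mem_ae_iff.2 (volume_thin A))

variable {K : Geometry.SimplicialComplex ℝ Plane} {u : Plane → ℝ} {y : Space}

theorem card_eq_three_of_notMem_thin (hK : IsTriangulation A K) {σ : Finset Plane}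
    (hσ : σ ∈ K.faces) (hu : IsBary σ u (proj y)) (hy : y ∉ thin A) : σ.card = 3 := by
  refine le_antisymm (card_le_three_of_mem_faces hσ) (not_lt.1 fun h => hy ?_)
  exact ⟨σ, hK.subset σ hσ, Nat.lt_succ_iff.1 h, convexHull_subset_affineSpan _ hu.mem_convexHull⟩

/-- The supporting plane of the carrying triangle agrees with the surface above `proj y` and is
nowhere above the lifted points, hence nowhere above their hull. -/
theorem IsRegular.height_le (hK : IsRegular ω A K) (hu : IsRep K u (proj y)) (hy : y ∉ thin A)
    {y' : Space} (hp : proj y' = proj y) (hy' : y' ∈ convexHull ℝ (lifted ω A : Set Space)) :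
    height ω A u ≤ y' 2 := by
  obtain ⟨σ, hσ, hu⟩ := hu
  obtain ⟨-, -, h, hh⟩ := (hK.2 σ (card_eq_three_of_notMem_thin hK.1 hσ hu hy)).1 hσ
  have hh' : ∀ p ∈ A, h p ≤ ω p ∧ (p ∈ σ ↔ h p = ω p) := fun p hp => by
    simpa only [proj_lift, lift_two, mem_lifted_iff] using hh _ (mem_lifted_iff.2 hp)
  have hσA := hK.1.subset σ hσ
  obtain ⟨w, hw, hw2⟩ := mem_convexHull_lifted_iff.1 hy'
  rw [hp] at hw
  rw [height_eq_sum hσA hu.zero, ← hw2]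
  calc ∑ p ∈ σ, u p * ω p = ∑ p ∈ σ, u p * h p :=
        Finset.sum_congr rfl fun p hp => by rw [((hh' p (hσA hp)).2.1 hp)]
    _ = ∑ p ∈ A, w p * h p := by rw [hu.sum_mul_affineMap, hw.sum_mul_affineMap]
    _ ≤ ∑ p ∈ A, w p * ω p :=
        Finset.sum_le_sum fun p hp => mul_le_mul_of_nonneg_left (hh' p hp).1 (hw.nonneg p)

theorem IsFarthestRegular.le_height (hK : IsFarthestRegular ω A K) (hu : IsRep K u (proj y))
    (hy : y ∉ thin A) {y' : Space} (hp : proj y' = proj y)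
    (hy' : y' ∈ convexHull ℝ (lifted ω A : Set Space)) : y' 2 ≤ height ω A u := by
  obtain ⟨σ, hσ, hu⟩ := hu
  obtain ⟨-, -, h, hh⟩ := (hK.2 σ (card_eq_three_of_notMem_thin hK.1 hσ hu hy)).1 hσ
  have hh' : ∀ p ∈ A, ω p ≤ h p ∧ (p ∈ σ ↔ h p = ω p) := fun p hp => by
    simpa only [proj_lift, lift_two, mem_lifted_iff] using hh _ (mem_lifted_iff.2 hp)
  have hσA := hK.1.subset σ hσ
  obtain ⟨w, hw, hw2⟩ := mem_convexHull_lifted_iff.1 hy'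
  rw [hp] at hw
  rw [height_eq_sum hσA hu.zero, ← hw2]
  calc ∑ p ∈ A, w p * ω p ≤ ∑ p ∈ A, w p * h p :=
        Finset.sum_le_sum fun p hp => mul_le_mul_of_nonneg_left (hh' p hp).1 (hw.nonneg p)
    _ = ∑ p ∈ σ, u p * h p := by rw [hu.sum_mul_affineMap, hw.sum_mul_affineMap]
    _ = ∑ p ∈ σ, u p * ω p :=
        Finset.sum_congr rfl fun p hp => by rw [((hh' p (hσA hp)).2.1 hp)]

theorem exists_above_below {S : Set Space} (hy : y ∈ interior S) :
    ∃ a ∈ S, ∃ b ∈ S, proj a = proj y ∧ proj b = proj y ∧ a 2 < y 2 ∧ y 2 < b 2 := by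
  obtain ⟨ε, hε, hb⟩ := Metric.mem_nhds_iff.1 (mem_interior_iff_mem_nhds.1 hy)
  have hmem : ∀ r : ℝ, |r| < ε → y + EuclideanSpace.single 2 r ∈ S := by
    intro r hr
    refine hb ?_
    rw [Metric.mem_ball, dist_eq_norm, add_sub_cancel_left, PiLp.norm_single]
    exact hr
  have hproj : ∀ r : ℝ, proj (y + EuclideanSpace.single 2 r) = proj y := by
    intro r
    ext i
    fin_cases i <;> simp [proj]
  have htwo : ∀ r : ℝ, (y + EuclideanSpace.single 2 r : Space) 2 = y 2 + r := by
    intro r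
    simp
  refine ⟨_, hmem (-(ε / 2)) ?_, _, hmem (ε / 2) ?_, hproj _, hproj _, ?_, ?_⟩
  · rw [abs_neg, abs_of_pos (half_pos hε)]; exact half_lt_self hε
  · rw [abs_of_pos (half_pos hε)]; exact half_lt_self hε
  · rw [htwo]; linarith
  · rw [htwo]; linarith

theorem interior_convexHull_lifted_nonempty (hcard : 4 ≤ A.card) (hω : GenericHeight ω A) :
    (interior (convexHull ℝ (lifted ω A : Set Space))).Nonempty := by
  obtain ⟨s, hs, hc⟩ := Finset.exists_subset_card_eq hcard
  rw [interior_convexHull_nonempty_iff_affineSpan_eq_top]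
  have h := (hω.affineIndependent hs hc).affineSpan_eq_top_iff_card_eq_finrank_add_one.2
    (by rw [Fintype.card_coe, lifted, Finset.card_map, hc, finrank_euclideanSpace_fin])
  rw [Subtype.range_coe] at h
  exact top_le_iff.1 (h.symm.le.trans
    (affineSpan_mono ℝ (Finset.coe_subset.2 (Finset.map_subset_map.2 hs))))

theorem convexHull_lifted_subset_closure (hcard : 4 ≤ A.card) (hω : GenericHeight ω A) :
    convexHull ℝ (lifted ω A : Set Space) ⊆
      closure (interior (convexHull ℝ (lifted ω A : Set Space)) ∩ (thin A)ᶜ) := by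
  refine subset_closure.trans ?_
  rw [← (convex_convexHull ℝ _).closure_interior_eq_closure_of_nonempty_interior
    (interior_convexHull_lifted_nonempty hcard hω)]
  exact closure_minimal ((dense_compl_thin A).open_subset_closure_inter isOpen_interior)
    isClosed_closure

theorem proj_mem_convexHull (hy : y ∈ convexHull ℝ (lifted ω A : Set Space)) :
    proj y ∈ convexHull ℝ (A : Set Plane) := by
  obtain ⟨w, hw, -⟩ := mem_convexHull_lifted_iff.1 hy
  exact hw.mem_convexHull

end Hull

/-! ### Assembling the triangulation -/

section Main

variable {m : ℕ} {T : Fin (m + 1) → Geometry.SimplicialComplex ℝ Plane} {Q : Fin m → Finset Plane}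

theorem iUnion_convexHull_lifted (hcard : 4 ≤ A.card) (hA : GeneralPosition A)
    (hω : GenericHeight ω A) (htri : ∀ j, IsTriangulation A (T j))
    (hT : ∀ i : Fin m, IsUpStep ω A (Q i) (T i.castSucc) (T i.succ))
    (h0 : IsRegular ω A (T 0)) (h1 : IsFarthestRegular ω A (T (Fin.last m))) :
    (⋃ i : Fin m, convexHull ℝ (lifted ω (Q i) : Set Space)) =
      convexHull ℝ (lifted ω A : Set Space) := by
  refine Set.Subset.antisymm (Set.iUnion_subset fun i => convexHull_mono
    (Finset.coe_subset.2 (Finset.map_subset_map.2 (hT i).subset))) ?_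
  have hcl : IsClosed (⋃ i : Fin m, convexHull ℝ (lifted ω (Q i) : Set Space)) :=
    isClosed_iUnion_of_finite fun i => (Finset.finite_toSet _).isClosed_convexHull ℝ
  refine (convexHull_lifted_subset_closure hcard hω).trans (closure_minimal ?_ hcl)
  rintro y ⟨hy, hthin⟩
  choose u hu using fun j => (htri j).exists_isRep (proj_mem_convexHull (interior_subset hy))
  obtain ⟨a, ha, b, hb, hpa, hpb, hay, hyb⟩ := exists_above_below hy
  exact Set.mem_iUnion.2 (exists_mem_convexHull_of_between hA hω hT hu
    ((h0.height_le (hu 0) hthin hpa ha).trans_lt hay)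
    (hyb.le.trans (h1.le_height (hu _) hthin hpb hb)))

/-- Over a generic interior point the top of the hull is strictly higher than the bottom, while
up-steps never lower the surface. -/
theorem not_isFarthestRegular_and_isRegular (hcard : 4 ≤ A.card) (hA : GeneralPosition A)
    (hω : GenericHeight ω A) (htri : ∀ j, IsTriangulation A (T j))
    (hT : ∀ i : Fin m, IsUpStep ω A (Q i) (T i.castSucc) (T i.succ)) :
    ¬ (IsFarthestRegular ω A (T 0) ∧ IsRegular ω A (T (Fin.last m))) := by
  rintro ⟨h0, h1⟩
  have hne := (interior_convexHull_lifted_nonempty hcard hω).mono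
    (interior_subset.trans (convexHull_lifted_subset_closure hcard hω))
  obtain ⟨y, hy, hthin⟩ := closure_nonempty_iff.1 hne
  choose u hu using fun j => (htri j).exists_isRep (proj_mem_convexHull (interior_subset hy))
  obtain ⟨a, ha, b, hb, hpa, hpb, hay, hyb⟩ := exists_above_below hy
  have k1 := h1.height_le (hu _) hthin hpa ha
  have k2 := h0.le_height (hu _) hthin hpb hb
  have k3 := height_rep_mono hA hω hT hu (Fin.zero_le (Fin.last m))
  linarith

/-- The complex of the faces of the tetrahedra of a sequence of steps. -/
def stepComplex (hA : GeneralPosition A) (hω : GenericHeight ω A)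
    (htri : ∀ j, IsTriangulation A (T j))
    (hT : ∀ i : Fin m, IsUpStep ω A (Q i) (T i.castSucc) (T i.succ)) :
    Geometry.SimplicialComplex ℝ Space where
  faces := {s | s.Nonempty ∧ ∃ i : Fin m, s ⊆ lifted ω (Q i)}
  isRelLowerSet_faces := fun _ hs => ⟨hs.1, fun _ hts ht =>
    ⟨ht, hs.2.imp fun _ hi => hts.trans hi⟩⟩
  indep := by
    rintro s ⟨-, i, hi⟩
    exact (hω.affineIndependent (hT i).subset (hT i).card).mono (Finset.coe_subset.2 hi)
  inter_subset_convexHull := by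
    classical
    rintro s t ⟨-, i, hi⟩ ⟨-, j, hj⟩ y ⟨hys, hyt⟩
    obtain ⟨σ, hσ, rfl⟩ := Finset.subset_map_iff.1 hi
    obtain ⟨τ, hτ, rfl⟩ := Finset.subset_map_iff.1 hj
    obtain ⟨w, hw, hwy⟩ := exists_height_of_mem_convexHull_lifted (hσ.trans (hT i).subset) hys
    obtain ⟨v, hv, hvy⟩ := exists_height_of_mem_convexHull_lifted (hτ.trans (hT j).subset) hyt
    -- One weight function now serves both simplices, so it vanishes off `σ ∩ τ`.
    have hwv := eq_of_height_eq hA hω htri hT (hw.mono hσ) (hv.mono hτ) (hwy.trans hvy.symm)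
    subst hwv
    rw [← Finset.coe_inter, ← Finset.map_inter]
    refine mem_convexHull_lifted_of_height
      (Finset.inter_subset_left.trans (hσ.trans (hT i).subset))
      (hw.restrict Finset.inter_subset_left fun p hp => ?_) hwy
    by_cases hpσ : p ∈ σ
    · exact hv.zero p fun hpτ => hp (Finset.mem_inter.2 ⟨hpσ, hpτ⟩)
    · exact hw.zero p hpσ

theorem exists_triangulation_of_isUpStep (hcard : 4 ≤ A.card) (hA : GeneralPosition A)
    (hω : GenericHeight ω A) (htri : ∀ j, IsTriangulation A (T j))
    (hT : ∀ i : Fin m, IsUpStep ω A (Q i) (T i.castSucc) (T i.succ))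
    (hends : (IsRegular ω A (T 0) ∧ IsFarthestRegular ω A (T (Fin.last m))) ∨
      (IsFarthestRegular ω A (T 0) ∧ IsRegular ω A (T (Fin.last m)))) :
    ∃ K : Geometry.SimplicialComplex ℝ Space,
      IsTriangulation (lifted ω A) K ∧
      (∀ s : Finset Space, s ∈ K.faces ↔ s.Nonempty ∧ ∃ i : Fin m, s ⊆ lifted ω (Q i)) ∧
      (∀ s : Finset Space, s ∈ K.faces ↔ (∃ i : Fin m, s = lifted ω (Q i)) ∨
        (∃ j : Fin (m + 1), ∃ σ ∈ (T j).faces, s = lifted ω σ)) ∧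
      (⋃ i : Fin m, convexHull ℝ (lifted ω (Q i) : Set Space)) =
        convexHull ℝ (lifted ω A : Set Space) ∧
      Function.Injective (fun i : Fin m => lifted ω (Q i)) := by
  obtain ⟨h0, h1⟩ := hends.resolve_right
    (not_isFarthestRegular_and_isRegular hcard hA hω htri hT)
  have hun := iUnion_convexHull_lifted hcard hA hω htri hT h0 h1
  have hQ : ∀ i, (Q i).Nonempty := fun i =>
    Finset.card_pos.1 (by rw [(hT i).card]; norm_num)
  refine ⟨stepComplex hA hω htri hT, ⟨?_, ?_⟩, fun s => Iff.rfl, fun s => ⟨?_, ?_⟩, hun,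
    (Finset.map_injective _).comp (injective_of_isUpStep hA hω htri hT)⟩
  · rintro s ⟨-, i, hi⟩
    exact hi.trans (Finset.map_subset_map.2 (hT i).subset)
  · rw [← hun]
    refine Set.Subset.antisymm (fun y hy => ?_) (Set.iUnion_subset fun i => ?_)
    · obtain ⟨s, ⟨-, i, hi⟩, hy⟩ := Geometry.SimplicialComplex.mem_space_iff.1 hy
      exact Set.mem_iUnion.2 ⟨i, convexHull_mono (Finset.coe_subset.2 hi) hy⟩
    · exact Geometry.SimplicialComplex.convexHull_subset_space
        (K := stepComplex hA hω htri hT) ⟨(hQ i).map, i, subset_rfl⟩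
  · rintro ⟨hs, i, hi⟩
    obtain ⟨σ, hσ, rfl⟩ := Finset.subset_map_iff.1 hi
    rcases hσ.eq_or_ssubset with rfl | hσ
    · exact Or.inl ⟨i, rfl⟩
    · right
      rcases (hT i).mem_faces_of_ssubset hA hω (Finset.map_nonempty.1 hs) hσ with h | h
      exacts [⟨_, σ, h, rfl⟩, ⟨_, σ, h, rfl⟩]
  · rintro (⟨i, rfl⟩ | ⟨j, σ, hσ, rfl⟩)
    · exact ⟨(hQ i).map, i, subset_rfl⟩
    · obtain ⟨i, hi⟩ := exists_subset_of_mem_faces hA hω htri hT hun.ge hσ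
      exact ⟨((T j).nonempty_of_mem_faces hσ).map, i, Finset.map_subset_map.2 hi⟩

end Main

end FlipTriangulation

theorem mainTheorem4
    (A : Finset FlipTriangulation.Plane) (ω : FlipTriangulation.Plane → ℝ)
    (hcard : 4 ≤ A.card)
    (hA : FlipTriangulation.GeneralPosition A)
    (hω : FlipTriangulation.GenericHeight ω A)
    (m : ℕ)
    (T : Fin (m + 1) → Geometry.SimplicialComplex ℝ FlipTriangulation.Plane)
    (Q : Fin m → Finset FlipTriangulation.Plane)
    (hmono : FlipTriangulation.IsMonotoneFlipSequence ω A m T Q)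
    (hends :
      (FlipTriangulation.IsRegular ω A (T 0) ∧
        FlipTriangulation.IsFarthestRegular ω A (T (Fin.last m))) ∨
      (FlipTriangulation.IsFarthestRegular ω A (T 0) ∧
        FlipTriangulation.IsRegular ω A (T (Fin.last m)))) :
    ∃ K : Geometry.SimplicialComplex ℝ FlipTriangulation.Space,
      -- `K` triangulates the lifted point set (closure, intersection and union properties)
      FlipTriangulation.IsTriangulation (FlipTriangulation.lifted ω A) K ∧
      -- its simplices are the faces of the tetrahedra of the flips
      (∀ s : Finset FlipTriangulation.Space,
        s ∈ K.faces ↔ s.Nonempty ∧ ∃ i : Fin m, s ⊆ FlipTriangulation.lifted ω (Q i)) ∧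
      -- equivalently, those tetrahedra and the simplices of the lifted triangulations
      (∀ s : Finset FlipTriangulation.Space,
        s ∈ K.faces ↔
          (∃ i : Fin m, s = FlipTriangulation.lifted ω (Q i)) ∨
          (∃ j : Fin (m + 1), ∃ σ ∈ (T j).faces, s = FlipTriangulation.lifted ω σ)) ∧
      -- the tetrahedra alone fill the convex hull of the lifted point set
      (⋃ i : Fin m, convexHull ℝ
          (FlipTriangulation.lifted ω (Q i) : Set FlipTriangulation.Space)) =
        convexHull ℝ (FlipTriangulation.lifted ω A : Set FlipTriangulation.Space) ∧
      -- different flips have different tetrahedra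
      Function.Injective (fun i : Fin m => FlipTriangulation.lifted ω (Q i)) := by
  rcases hmono with hT | hT
  · have hstep := fun i => (hT i).isUpStep
    refine FlipTriangulation.exists_triangulation_of_isUpStep hcard hA hω (fun j => ?_) hstep hends
    induction j using Fin.cases with
    | zero => exact hends.elim (fun h => h.1.1) fun h => h.1.1
    | succ i => exact (hstep i).right
  -- Reversing the indices turns down-flips into up-steps and swaps the two ends.
  · have hstep : ∀ i : Fin m, FlipTriangulation.IsUpStep ω A (Q i.rev) (T i.castSucc.rev)
        (T i.succ.rev) := by
      intro i
      rw [Fin.rev_castSucc, Fin.rev_succ]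
      exact (hT i.rev).isUpStep
    have htri : ∀ j, FlipTriangulation.IsTriangulation A (T j) := by
      intro j
      induction j using Fin.cases with
      -- `T 0` is handled through `hends`, since there may be no flips at all.
      | zero => exact hends.elim (fun h => h.1.1) fun h => h.1.1
      | succ i => exact (hT i).isUpStep.left
    obtain ⟨K, hK, h1, h2, h3, h4⟩ := FlipTriangulation.exists_triangulation_of_isUpStep
      (T := fun j => T j.rev) (Q := fun i => Q i.rev) hcard hA hω (fun j => htri j.rev) hstep (by
        rw [Fin.rev_zero, Fin.rev_last]
        exact hends.symm.imp And.symm And.symm)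
    refine ⟨K, hK, fun s => (h1 s).trans ?_, fun s => (h2 s).trans ?_, ?_, fun i j hij => ?_⟩
    · exact and_congr_right' (Fin.rev_surjective.exists
        (p := fun i => s ⊆ FlipTriangulation.lifted ω (Q i))).symm
    · exact or_congr (Fin.rev_surjective.exists
        (p := fun i => s = FlipTriangulation.lifted ω (Q i))).symm
        (Fin.rev_surjective.exists
          (p := fun j => ∃ σ ∈ (T j).faces, s = FlipTriangulation.lifted ω σ)).symm
    · rw [← h3]
      exact (Fin.revPerm.surjective.iUnion_comp _).symm
    · exact Fin.rev_injective (h4 (by simpa using hij))
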